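/- Let $X=\operatorname{Spec}R$ be a normal affine variety over $\mathbf{C}$ with an algebraic $\mathbf{C}^*$-action $\{\phi_t\}_{t\in\mathbf{C}^*}$ having only positive weights, i.e. $R=\bigoplus_{i\ge 0}R_i$ with $R_0=\mathbf{C}$, where $R_i=\{f : \phi_t^*f=t^if \text{ for all } t\in\mathbf{C}^*\}$. Let $\omega$ be an algebraic symplectic 2-form on the regular part $X_{reg}$ (so $\dim X$ is even) of weight $l$, that is, $\phi_t^*\omega=t^l\omega$ for all $t$, with $l\in\mathbf{Z}$, $l\neq 0$. Let $\{\,,\,\}$ be the Poisson structure on $X$ determined by $\omega$: the bracket on $X_{reg}$ given by $\{f,g\}=\omega(H_f,H_g)$, $\omega(H_f,\cdot)=df$, extended to $X$ by normality. Put $S_1=\operatorname{Spec}\mathbf{C}[\epsilon]$ with $\epsilon^2=0$, and let $\mathbf{C}^*$ act on $X\times S_1$ by the given action on the first factor and trivially on the second. Let $\{\,,\,\}_{\epsilon,1}$ and $\{\,,\,\}_{\epsilon,2}$ be two Poisson structures on $X\times S_1$ relative to $S_1$ (that is, $\mathbf{C}[\epsilon]$-bilinear Poisson brackets on $R[\epsilon]$),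 both inducing $\{\,,\,\}$ on $X\times\{0\}$ and both of weight $-l$ (the bracket of homogeneous elements of weights $a$ and $b$ is homogeneous of weight $a+b-l$). Then there is a $\mathbf{C}^*$-equivariant automorphism of $X\times S_1$ over $S_1$ which induces the identity on $X\times\{0\}$ and sends $\{\,,\,\}_{\epsilon,1}$ to $\{\,,\,\}_{\epsilon,2}$. -/

import Mathlib

noncomputable section

namespace SymplecticCone

/-! ### Torus actions on affine varieties -/

section Torus

variable {A : Type*} [CommRing A] [Algebra ℂ A]

/-- For an action of `ℂˣ` on the ring `A` of functions (with `ρ t = φ_t^*`), the space of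
functions of weight `n`, i.e. those with `φ_t^* f = t ^ n f` for all `t`. -/
def weightSpace (ρ : ℂˣ →* (A ≃ₐ[ℂ] A)) (n : ℤ) : Submodule ℂ A where
  carrier := {f | ∀ t : ℂˣ, ρ t f = ((t : ℂ) ^ n) • f}
  add_mem' := by
    intro f g hf hg t
    rw [map_add, hf t, hg t, smul_add]
  zero_mem' := by
    intro t
    simp
  smul_mem' := by
    intro c f hf t
    rw [map_smul, hf t, smul_comm]

/-- The action is algebraic, and it makes `A` a positively graded ring
`A = ⨁_{i ≥ 0} A_i` with `A_0 = ℂ`. (The sum of weight spaces is automatically direct.) -/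
structure IsPositiveAction (ρ : ℂˣ →* (A ≃ₐ[ℂ] A)) : Prop where
  algebraic : ⨆ n : ℤ, weightSpace ρ n = ⊤
  nonneg : ∀ n : ℤ, n < 0 → weightSpace ρ n = ⊥
  zero : weightSpace ρ 0 = Subalgebra.toSubmodule (⊥ : Subalgebra ℂ A)

/-- The automorphism `a + ε b ↦ σ a + ε σ b` of `A[ε]`. -/
def dualNumberMap (σ : A ≃ₐ[ℂ] A) : DualNumber A ≃ₐ[ℂ] DualNumber A where
  toFun x := TrivSqZeroExt.inl (σ x.fst) + TrivSqZeroExt.inr (σ x.snd)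
  invFun x := TrivSqZeroExt.inl (σ.symm x.fst) + TrivSqZeroExt.inr (σ.symm x.snd)
  left_inv x := by ext <;> simp
  right_inv x := by ext <;> simp
  map_mul' x y := by ext <;> simp
  map_add' x y := by ext <;> simp
  commutes' c := by ext <;> simp [TrivSqZeroExt.algebraMap_eq_inl']

/-- The induced action on `X × Spec ℂ[ε]`, trivial on the second factor. -/
def dualNumberAction (ρ : ℂˣ →* (A ≃ₐ[ℂ] A)) : ℂˣ →* (DualNumber A ≃ₐ[ℂ] DualNumber A) where
  toFun t := dualNumberMap (ρ t)
  map_one' := by ext x <;> simp [dualNumberMap]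
  map_mul' s t := by ext x <;> simp [dualNumberMap]

end Torus

set_option linter.unusedSectionVars false

/-! ### Rational functions, vector fields and 2-forms on an affine variety -/

section Forms

variable (R : Type*) [CommRing R] [IsDomain R] [Algebra ℂ R]

/-- Rational vector fields on `X = Spec R`: derivations of the function field over `ℂ`. -/
abbrev RatField : Type _ := Derivation ℂ (FractionRing R) (FractionRing R)

variable {R}

/-- The local ring `O_{X,p}` inside the function field. -/
abbrev localRing (p : PrimeSpectrum R) : Subalgebra R (FractionRing R) :=
  Localization.subalgebra.ofField (FractionRing R) p.asIdeal.primeCompl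
    p.asIdeal.primeCompl_le_nonZeroDivisors

variable (R) in
/-- The regular part `X_reg` of `X = Spec R`. -/
def regularPart : Set (PrimeSpectrum R) :=
  {p | IsRegularLocalRing (Localization.AtPrime p.asIdeal)}

/-- The stalk `Θ_{X,p}` of the tangent sheaf: rational vector fields which are regular at `p`,
i.e. which preserve `O_{X,p}`. -/
def vectorFieldsAt (p : PrimeSpectrum R) : Submodule (localRing p) (RatField R) where
  carrier := {D | ∀ f ∈ localRing p, D f ∈ localRing p}
  add_mem' := by
    intro D E hD hE f hf
    exact add_mem (hD f hf) (hE f hf)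
  zero_mem' := by
    intro f _
    exact zero_mem _
  smul_mem' := by
    intro c D hD f hf
    exact mul_mem c.2 (hD f hf)

variable (R) in
/-- An algebraic 2-form on `X_reg`: a rational 2-form, given as an alternating bilinear form on
rational vector fields, that is regular at every point of `X_reg`. (On the regular part,
`Ω²` is the dual of `⋀² Θ`, and all these sheaves are locally free.) -/
structure TwoForm where
  form : LinearMap.BilinForm (FractionRing R) (RatField R)
  alt : form.IsAlt
  regular : ∀ p ∈ regularPart R, ∀ D ∈ vectorFieldsAt p, ∀ E ∈ vectorFieldsAt p,
    form D E ∈ localRing p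

/-- `dω = 0`. -/
def TwoForm.IsClosed (ω : TwoForm R) : Prop :=
  ∀ D E F : RatField R,
    D (ω.form E F) - E (ω.form D F) + F (ω.form D E)
      - ω.form ⁅D, E⁆ F + ω.form ⁅D, F⁆ E - ω.form ⁅E, F⁆ D = 0

/-- At each point `p` of `X_reg`, `D ↦ ω(D, ·)` is a bijection from `Θ_{X,p}` onto
`Ω¹_{X,p} = Hom(Θ_{X,p}, O_{X,p})`. -/
def TwoForm.IsNondegenerate (ω : TwoForm R) : Prop :=
  ∀ p ∈ regularPart R, ∀ α : vectorFieldsAt p →ₗ[localRing p] localRing p,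
    ∃! D : vectorFieldsAt p, ∀ E : vectorFieldsAt p,
      ω.form (D : RatField R) (E : RatField R) = (α E : FractionRing R)

variable (R) in
/-- Algebraic symplectic 2-forms on `X_reg`. -/
structure SymplecticForm extends TwoForm R where
  closed : toTwoForm.IsClosed
  nondegenerate : toTwoForm.IsNondegenerate

/-- The automorphism of the function field induced by an automorphism of `R`. -/
def fieldMap (σ : R ≃ₐ[ℂ] R) : FractionRing R ≃ₐ[ℂ] FractionRing R :=
  IsFractionRing.fieldEquivOfAlgEquiv ℂ (FractionRing R) (FractionRing R) σ

/-- The push-forward `φ_* D = (φ^*)⁻¹ ∘ D ∘ φ^*` of a rational vector field along the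
automorphism `φ` of `X` with `φ^* = σ`. -/
def pushforward (σ : R ≃ₐ[ℂ] R) (D : RatField R) : RatField R :=
  Derivation.mk' ((fieldMap σ).symm.toLinearMap ∘ₗ (D : FractionRing R →ₗ[ℂ] FractionRing R) ∘ₗ
    (fieldMap σ).toLinearMap) (by intro a b; simp)

/-- `ω` has weight `l`: `φ_t^* ω = t ^ l ω`, where
`(φ^* ω)(D, E) = φ^* (ω (φ_* D, φ_* E))`. -/
def TwoForm.HasWeight (ω : TwoForm R) (ρ : ℂˣ →* (R ≃ₐ[ℂ] R)) (l : ℤ) : Prop :=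
  ∀ (t : ℂˣ) (D E : RatField R),
    fieldMap (ρ t) (ω.form (pushforward (ρ t) D) (pushforward (ρ t) E))
      = ((t : ℂ) ^ l) • ω.form D E

/-- The generic point is a regular point. -/
theorem bot_mem_regularPart : (⊥ : PrimeSpectrum R) ∈ regularPart R := by
  have h : IsFractionRing R (Localization.AtPrime (⊥ : PrimeSpectrum R).asIdeal) := by
    have h0 : (⊥ : PrimeSpectrum R).asIdeal.primeCompl = nonZeroDivisors R := by
      ext x
      simp [Ideal.primeCompl]
    change IsLocalization _ _
    rw [← h0]
    infer_instance
  let _ : Field (Localization.AtPrime (⊥ : PrimeSpectrum R).asIdeal) :=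
    IsFractionRing.toField R
  change IsRegularLocalRing (Localization.AtPrime (⊥ : PrimeSpectrum R).asIdeal)
  infer_instance

theorem mem_localRing_bot (f : FractionRing R) : f ∈ localRing (⊥ : PrimeSpectrum R) := by
  obtain ⟨a, s, hs, rfl⟩ := IsFractionRing.div_surjective R f
  refine ⟨a, s, ?_, div_eq_mul_inv _ _⟩
  change s ∉ (⊥ : Ideal R)
  simpa using nonZeroDivisors.ne_zero hs

theorem SymplecticForm.existsUnique_hamiltonian (ω : SymplecticForm R) (f : FractionRing R) :
    ∃! H : RatField R, ∀ Z : RatField R, ω.form H Z = Z f := by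
  let α : vectorFieldsAt (⊥ : PrimeSpectrum R) →ₗ[localRing (⊥ : PrimeSpectrum R)]
      localRing (⊥ : PrimeSpectrum R) :=
    { toFun := fun D => ⟨(D : RatField R) f, mem_localRing_bot _⟩
      map_add' := fun _ _ => rfl
      map_smul' := by
        intro c D
        apply Subtype.ext
        change ((c • (D : RatField R)) : RatField R) f = (c : FractionRing R) * (D : RatField R) f
        rw [Derivation.smul_apply]
        rfl }
  obtain ⟨H, hH, hu⟩ := ω.nondegenerate ⊥ bot_mem_regularPart α
  refine ⟨H, fun Z => hH ⟨Z, fun g _ => mem_localRing_bot _⟩, fun H' hH' => ?_⟩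
  exact congrArg Subtype.val (hu ⟨H', fun g _ => mem_localRing_bot _⟩ fun E => hH' E)

/-- The Hamiltonian vector field `H_f`, defined by `ω(H_f, ·) = df`. -/
def SymplecticForm.hamiltonian (ω : SymplecticForm R) (f : FractionRing R) : RatField R :=
  (ω.existsUnique_hamiltonian f).choose

/-- The Poisson bracket `{f, g} = ω(H_f, H_g)` of a symplectic form, on rational functions. -/
def SymplecticForm.bracket (ω : SymplecticForm R) (f g : FractionRing R) : FractionRing R :=
  ω.form (ω.hamiltonian f) (ω.hamiltonian g)

end Forms

/-! ### First order Poisson structures -/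

section Poisson

variable (R : Type*) [CommRing R] [Algebra ℂ R]

/-- A Poisson structure on `X × Spec ℂ[ε]` relative to `Spec ℂ[ε]`, where `X = Spec R`:
a `ℂ[ε]`-bilinear Poisson bracket on `R[ε] = R ⊕ ε R`. -/
structure FirstOrderPoisson where
  bracket : DualNumber R →ₗ[ℂ] DualNumber R →ₗ[ℂ] DualNumber R
  eps_mul_left : ∀ x y, bracket (DualNumber.eps * x) y = DualNumber.eps * bracket x y
  eps_mul_right : ∀ x y, bracket x (DualNumber.eps * y) = DualNumber.eps * bracket x y
  self : ∀ x, bracket x x = 0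
  leibniz : ∀ x y z, bracket x (y * z) = bracket x y * z + y * bracket x z
  jacobi : ∀ x y z,
    bracket x (bracket y z) + bracket y (bracket z x) + bracket z (bracket x y) = 0

variable {R}

/-- The bracket has weight `m`: it takes elements of weights `a`, `b` to an element of
weight `a + b + m`. -/
def FirstOrderPoisson.HasWeight (P : FirstOrderPoisson R) (ρ : ℂˣ →* (R ≃ₐ[ℂ] R)) (m : ℤ) :
    Prop :=
  ∀ (a b : ℤ), ∀ x ∈ weightSpace (dualNumberAction ρ) a,
    ∀ y ∈ weightSpace (dualNumberAction ρ) b,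
      P.bracket x y ∈ weightSpace (dualNumberAction ρ) (a + b + m)

/-- The bracket induces on `X × {0}` the Poisson structure of the symplectic form `ω`. -/
def FirstOrderPoisson.Extends [IsDomain R] (P : FirstOrderPoisson R) (ω : SymplecticForm R) :
    Prop :=
  ∀ x y : DualNumber R, algebraMap R (FractionRing R) (P.bracket x y).fst
    = ω.bracket (algebraMap R (FractionRing R) x.fst) (algebraMap R (FractionRing R) y.fst)

end Poisson

end SymplecticCone

end

/-!
The two brackets have the form `{x, y} + ε β₁(x, y)` and `{x, y} + ε β₂(x, y)` on `R`. Their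
difference `δ = β₁ - β₂` is a biderivation of `R`, of weight `-l`, and a cocycle for the Poisson
differential. The automorphism `id + ε v` given by a vector field `v` carries one bracket to the
other if and only if `δ(x, y) = {v x, y} + {x, v y} - v {x, y}` (`infinitesimalAut_bracket`), so an
invariant vector field with coboundary `δ` has to be found.

Under `ω` the bivector `δ` corresponds to a closed 2-form `α` of weight `l` on `X_reg`. By Cartan's
formula for the Euler vector field `E`, `l α = d(i_E α)`, and as `l ≠ 0` the cocycle `δ` is the
coboundary of the vector field `v` that corresponds to `i_E α / l`. In terms of `ω` this is
`v(f) = -ω(E, δ(·, f)) / l`, an expression in which neither `α` nor coordinates occur.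

* `mem_range_of_forall_mem_regularPart`: as `X` is normal, functions that are regular on `X_reg`
  are regular. The vector fields `E` and `δ(·, f)` preserve `R`, hence are regular everywhere, so
  `v(f)` is regular on `X_reg`, and `v` is a derivation of `R` (`exists_derivation_eq_form`).
* `exteriorDerivative_contraction`: `d(i_E ω) = l ω`. On Hamiltonian vector fields this says that
  the bracket has weight `-l`; they span all rational vector fields, by nondegeneracy at the
  generic point (`SymplecticForm.span_hamiltonian`).
* `cocycle_eq_coboundary`: the cocycle condition expresses `δ(·, {x, y})` through commutators of
  Hamiltonian vector fields with the fields `δ(·, x)` and `δ(·, y)`; substituting `d(i_E ω) = l ω`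
  gives the coboundary of `v`.
* `torus_apply_of_eq_form`: the weights of `ω` and `δ` cancel, so `v` is invariant.
-/

noncomputable section

namespace SymplecticCone

set_option linter.unusedSectionVars false

/-! ### Functions on a normal variety that are regular on the regular part -/

section Normal

variable {R : Type*} [CommRing R] [IsDomain R] [Algebra ℂ R]

theorem mem_localRing_iff {p : PrimeSpectrum R} {x : FractionRing R} :
    x ∈ localRing p ↔
      ∃ a s : R, s ∉ p.asIdeal ∧ algebraMap R (FractionRing R) s * x = algebraMap R _ a := by
  constructor
  · rintro ⟨a, s, hs, rfl⟩
    refine ⟨a, s, hs, ?_⟩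
    have : algebraMap R (FractionRing R) s ≠ 0 := by
      rw [Ne, FaithfulSMul.algebraMap_eq_zero_iff]
      rintro rfl
      exact hs (zero_mem _)
    field_simp
  · rintro ⟨a, s, hs, h⟩
    have : algebraMap R (FractionRing R) s ≠ 0 := by
      rw [Ne, FaithfulSMul.algebraMap_eq_zero_iff]
      rintro rfl
      exact hs (zero_mem _)
    refine ⟨a, s, hs, ?_⟩
    rw [← h]
    field_simp

/-- If the maximal ideal of `R_p` is generated by the image of an element `c` of `p`, then `p` is
a regular point, because `R_p` is then a principal ideal ring. -/
theorem mem_regularPart_of_exists_generator [IsNoetherianRing R] (p : PrimeSpectrum R) (c : R)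
    (hc : c ∈ p.asIdeal) (h : ∀ s ∈ p.asIdeal, ∃ u ∉ p.asIdeal, c ∣ u * s) :
    p ∈ regularPart R := by
  let A := Localization.AtPrime p.asIdeal
  have : IsDomain A := IsLocalization.isDomain_localization p.asIdeal.primeCompl_le_nonZeroDivisors
  have : IsNoetherianRing A := IsLocalization.isNoetherianRing p.asIdeal.primeCompl A inferInstance
  have hm : (IsLocalRing.maximalIdeal A).IsPrincipal := by
    refine ⟨algebraMap R A c, ?_⟩
    rw [← IsLocalization.AtPrime.map_eq_maximalIdeal p.asIdeal A]
    apply le_antisymm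
    · rw [Ideal.map_le_iff_le_comap]
      intro s hs
      obtain ⟨u, hu, w, hw⟩ := h s hs
      rw [Ideal.mem_comap]
      have hu' : IsUnit (algebraMap R A u) := 
        IsLocalization.map_units A (⟨u, hu⟩ : p.asIdeal.primeCompl)
      rw [← Ideal.unit_mul_mem_iff_mem _ hu', ← map_mul, hw, map_mul]
      exact Ideal.mul_mem_right _ _ (Ideal.mem_span_singleton_self _)
    · rw [Ideal.submodule_span_eq, Ideal.span_singleton_le_iff_mem]
      exact Ideal.mem_map_of_mem _ hc
  have : IsPrincipalIdealRing A :=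
    ((tfae_of_isNoetherianRing_of_isLocalRing_of_isDomain A).out 0 4).mpr hm
  change IsRegularLocalRing A
  infer_instance

/-- On a normal variety every rational function that is regular on `X_reg` is regular. If `x ∉ R`,
its denominators lie in an associated prime `p` of `K / R`, so `x` has a pole at `p`. Writing
`p = {s | s y ∈ R}`, either `y p ⊆ p` and `y ∈ R` by integrality, which is absurd, or `p R_p` is
principal and `p` is a regular point. -/
theorem mem_range_of_forall_mem_regularPart [IsNoetherianRing R] [IsIntegrallyClosed R]
    (x : FractionRing R) (hx : ∀ p ∈ regularPart R, x ∈ localRing p) :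
    ∃ r : R, algebraMap R (FractionRing R) r = x := by
  by_contra hcon
  let K := FractionRing R
  let N : Submodule R K := LinearMap.range (Algebra.linearMap R K)
  have hmem (z : K) : z ∈ N ↔ ∃ r : R, algebraMap R K r = z := Iff.rfl
  have hx0 : N.mkQ x ≠ 0 := by
    rwa [Ne, Submodule.mkQ_apply, Submodule.Quotient.mk_eq_zero]
  obtain ⟨P, hP, hxP⟩ := exists_le_isAssociatedPrime_of_isNoetherianRing R (N.mkQ x) hx0
  obtain ⟨hPp, q, hq⟩ := isAssociatedPrime_iff.mp hP
  obtain ⟨y, rfl⟩ := N.mkQ_surjective q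
  have hPy (s : R) : s ∈ P ↔ ∃ r : R, algebraMap R K r = algebraMap R K s * y := by
    rw [hq, Submodule.mem_colon_singleton, Submodule.mem_bot, ← map_smul, Submodule.mkQ_apply,
      Submodule.Quotient.mk_eq_zero, hmem, Algebra.smul_def]
  have hPx (s r : R) (h : algebraMap R K s * x = algebraMap R K r) : s ∈ P := by
    apply hxP
    rw [Submodule.mem_colon_singleton, Submodule.mem_bot, ← map_smul, Submodule.mkQ_apply,
      Submodule.Quotient.mk_eq_zero, hmem, Algebra.smul_def]
    exact ⟨r, h.symm⟩
  suffices hreg : (⟨P, hPp⟩ : PrimeSpectrum R) ∈ regularPart R by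
    obtain ⟨a, s, hs, h⟩ := mem_localRing_iff.mp (hx _ hreg)
    exact hs (hPx s a h)
  by_cases hint : ∀ s ∈ P, ∃ r ∈ P, algebraMap R K r = algebraMap R K s * y
  · exfalso
    obtain ⟨a, s, hs, hy⟩ := IsFractionRing.div_surjective R y
    have hs0 : algebraMap R K s ≠ 0 := by simpa using nonZeroDivisors.ne_zero hs
    have hsP : s ∈ P := (hPy s).mpr ⟨a, by rw [← hy, mul_div_cancel₀ _ hs0]⟩
    have hy_int : IsIntegral R y := by
      refine isIntegral_of_smul_mem_submodule
        (Submodule.map (Algebra.linearMap R K) P) ?_ ?_ y ?_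
      · rw [Submodule.ne_bot_iff]
        exact ⟨_, ⟨s, hsP, rfl⟩, hs0⟩
      · exact Submodule.FG.map _ (IsNoetherian.noetherian P)
      · rintro _ ⟨s, hs, rfl⟩
        obtain ⟨r, hr, h⟩ := hint s hs
        exact ⟨r, hr, by simpa [mul_comm] using h⟩
    obtain ⟨r, hr⟩ := IsIntegrallyClosed.algebraMap_eq_of_integral hy_int
    exact hPp.ne_top ((Ideal.eq_top_iff_one P).mpr ((hPy 1).mpr ⟨r, by simpa using hr⟩))
  · push Not at hint
    obtain ⟨c, hc, hcu⟩ := hint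
    obtain ⟨u, hu⟩ := (hPy c).mp hc
    refine mem_regularPart_of_exists_generator _ c hc fun s hs => ?_
    obtain ⟨r, hr⟩ := (hPy s).mp hs
    refine ⟨u, fun h => hcu u h hu, r, ?_⟩
    apply IsFractionRing.injective R K
    rw [map_mul, map_mul, hu, hr]
    ring

end Normal

/-! ### Extending derivations to the function field -/

section Extend

variable {R : Type*} [CommRing R] [IsDomain R] [Algebra ℂ R]

/-- A derivation `D` of `R` as the homomorphism `a ↦ a + ε D a` from `R` to the dual numbers over
the function field. -/
def toDualNumberHom (D : Derivation ℂ R R) : R →ₐ[ℂ] DualNumber (FractionRing R) where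
  toFun a := TrivSqZeroExt.inl (algebraMap R _ a) + TrivSqZeroExt.inr (algebraMap R _ (D a))
  map_one' := by ext <;> simp
  map_zero' := by ext <;> simp
  map_add' a b := by ext <;> simp [Algebra.smul_def, -algebraMap_smul]
  map_mul' a b := by
    ext
    · simp
    · simp only [Derivation.leibniz, map_add, map_mul, TrivSqZeroExt.snd_add,
        TrivSqZeroExt.snd_mul, TrivSqZeroExt.snd_inl, TrivSqZeroExt.snd_inr,
        TrivSqZeroExt.fst_add, TrivSqZeroExt.fst_inl, TrivSqZeroExt.fst_inr,
        op_smul_eq_smul, smul_eq_mul, zero_add, add_zero]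
  commutes' c := by
    ext <;> simp [TrivSqZeroExt.algebraMap_eq_inl', ← IsScalarTower.algebraMap_apply]

/-- The homomorphism `K → K[ε]` that extends `toDualNumberHom D`. -/
def fieldToDualNumberHom (D : Derivation ℂ R R) :
    FractionRing R →ₐ[ℂ] DualNumber (FractionRing R) :=
  IsLocalization.liftAlgHom (M := nonZeroDivisors R) (f := toDualNumberHom D) fun s => by
    rw [TrivSqZeroExt.isUnit_iff_isUnit_fst]
    simp [toDualNumberHom]

theorem fieldToDualNumberHom_algebraMap (D : Derivation ℂ R R) (a : R) :
    fieldToDualNumberHom D (algebraMap R _ a) = toDualNumberHom D a :=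
  IsLocalization.lift_eq _ a

theorem fst_fieldToDualNumberHom (D : Derivation ℂ R R) (f : FractionRing R) :
    (fieldToDualNumberHom D f).fst = f := by
  obtain ⟨a, s, hs, rfl⟩ := IsFractionRing.div_surjective R f
  have hs0 : algebraMap R (FractionRing R) s ≠ 0 := by simpa using nonZeroDivisors.ne_zero hs
  have h := congrArg (fun f => (fieldToDualNumberHom D f).fst)
    (div_mul_cancel₀ (algebraMap R (FractionRing R) a) hs0)
  simp only [map_mul, TrivSqZeroExt.fst_mul, fieldToDualNumberHom_algebraMap, toDualNumberHom,
    AlgHom.coe_mk, RingHom.coe_mk, MonoidHom.coe_mk, OneHom.coe_mk, TrivSqZeroExt.fst_add,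
    TrivSqZeroExt.fst_inl, TrivSqZeroExt.fst_inr, add_zero] at h
  rwa [eq_div_iff hs0]

/-- The extension of a derivation of `R` to the function field, i.e. a regular vector field
considered as a rational one. -/
def extendToField (D : Derivation ℂ R R) : RatField R :=
  Derivation.mk' ((TrivSqZeroExt.sndHom (FractionRing R) (FractionRing R)).restrictScalars ℂ ∘ₗ
    (fieldToDualNumberHom D).toLinearMap) (by
      intro a b
      simp [fst_fieldToDualNumberHom, mul_comm])

@[simp]
theorem extendToField_algebraMap (D : Derivation ℂ R R) (a : R) :
    extendToField D (algebraMap R _ a) = algebraMap R _ (D a) := by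
  change (fieldToDualNumberHom D (algebraMap R _ a)).snd = _
  rw [fieldToDualNumberHom_algebraMap]
  exact zero_add _

theorem RatField.ext_of_algebraMap {D E : RatField R}
    (h : ∀ a : R, D (algebraMap R _ a) = E (algebraMap R _ a)) : D = E := by
  ext f
  obtain ⟨a, s, hs, rfl⟩ := IsFractionRing.div_surjective R f
  rw [Derivation.leibniz_div, Derivation.leibniz_div, h a, h s]

/-- A rational vector field that preserves `R` is regular at every point of `Spec R`. -/
theorem mem_vectorFieldsAt_of_algebraMap {D : RatField R}
    (h : ∀ a : R, ∃ b : R, D (algebraMap R _ a) = algebraMap R _ b) (p : PrimeSpectrum R) :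
    D ∈ vectorFieldsAt p := by
  rintro _ ⟨a, s, hs, rfl⟩
  have hs0 : algebraMap R (FractionRing R) s ≠ 0 := by
    rw [Ne, FaithfulSMul.algebraMap_eq_zero_iff]
    rintro rfl
    exact hs (zero_mem _)
  obtain ⟨a', ha⟩ := h a
  obtain ⟨s', hs'⟩ := h s
  refine mem_localRing_iff.mpr
    ⟨s * a' - a * s', s ^ 2, fun h => hs (p.isPrime.mem_of_pow_mem 2 h), ?_⟩
  rw [← div_eq_mul_inv, Derivation.leibniz_div, ha, hs']
  simp only [smul_eq_mul, map_pow, map_sub, map_mul]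
  field_simp

end Extend

/-! ### Weights and the Euler vector field -/

section Euler

variable {A : Type*} [CommRing A] [Algebra ℂ A] {ρ : ℂˣ →* (A ≃ₐ[ℂ] A)}

theorem mul_mem_weightSpace {a b : ℤ} {x y : A} (hx : x ∈ weightSpace ρ a)
    (hy : y ∈ weightSpace ρ b) : x * y ∈ weightSpace ρ (a + b) := by
  intro t
  rw [map_mul, hx t, hy t, zpow_add₀ t.ne_zero, smul_mul_smul_comm]

/-- The weight spaces lie in eigenspaces of the element `2` of the torus, whose eigenvalues
`2 ^ n` are distinct. -/
theorem iSupIndep_weightSpace (ρ : ℂˣ →* (A ≃ₐ[ℂ] A)) : iSupIndep (weightSpace ρ) := by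
  let u : ℂˣ := Units.mk0 2 two_ne_zero
  have hinj : Function.Injective fun n : ℤ => (u : ℂ) ^ n := by
    intro m n h
    have h' : (2 : ℝ) ^ m = (2 : ℝ) ^ n := by
      have h2 := congrArg norm h
      simpa [u] using h2
    exact zpow_right_injective₀ (by norm_num) (by norm_num) h'
  refine ((Module.End.eigenspaces_iSupIndep (ρ u).toLinearMap).comp hinj).mono fun n f hf => ?_
  exact Module.End.mem_eigenspace_iff.mpr (hf u)

/-- A property of functions that is stable under addition holds for all functions as soon as it
holds for the homogeneous ones. -/
theorem weight_induction (hρ : ⨆ n : ℤ, weightSpace ρ n = ⊤) {p : A → Prop}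
    (hom : ∀ n : ℤ, ∀ x ∈ weightSpace ρ n, p x) (add : ∀ x y, p x → p y → p (x + y)) (x : A) :
    p x := by
  have hx : x ∈ ⨆ n : ℤ, weightSpace ρ n := hρ ▸ Submodule.mem_top
  exact Submodule.iSup_induction (weightSpace ρ) (motive := p) hx hom (hom 0 0 (zero_mem _)) add

/-- The linear map that is multiplication by `n` on functions of weight `n`. -/
theorem exists_eulerLinearMap (hρ : ⨆ n : ℤ, weightSpace ρ n = ⊤) :
    ∃ E : A →ₗ[ℂ] A, ∀ n : ℤ, ∀ x ∈ weightSpace ρ n, E x = (n : ℂ) • x := by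
  have hint : DirectSum.IsInternal (weightSpace ρ) :=
    DirectSum.isInternal_submodule_of_iSupIndep_of_iSup_eq_top (iSupIndep_weightSpace ρ) hρ
  let e := LinearEquiv.ofBijective (DirectSum.coeLinearMap (weightSpace ρ)) hint
  let F : (DirectSum ℤ fun n => weightSpace ρ n) →ₗ[ℂ] A :=
    DirectSum.toModule ℂ ℤ A fun n => (n : ℂ) • (weightSpace ρ n).subtype
  refine ⟨F ∘ₗ e.symm.toLinearMap, fun n x hx => ?_⟩
  have he : e (DirectSum.lof ℂ ℤ (fun n => weightSpace ρ n) n ⟨x, hx⟩) = x :=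
    DirectSum.coeLinearMap_lof (weightSpace ρ) n ⟨x, hx⟩
  have he' : e.symm x = DirectSum.lof ℂ ℤ (fun n => weightSpace ρ n) n ⟨x, hx⟩ := by
    rw [LinearEquiv.symm_apply_eq, he]
  simp [he', F]

/-- The Euler vector field, which generates the action of the torus. -/
theorem exists_euler (hρ : ⨆ n : ℤ, weightSpace ρ n = ⊤) :
    ∃ E : Derivation ℂ A A, ∀ n : ℤ, ∀ x ∈ weightSpace ρ n, E x = (n : ℂ) • x := by
  obtain ⟨E, hE⟩ := exists_eulerLinearMap hρ
  refine ⟨Derivation.mk' E fun x y => ?_, hE⟩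
  induction x using weight_induction hρ with
  | add x x' hx hx' =>
    rw [add_mul, map_add, hx, hx', map_add]
    simp only [smul_eq_mul]
    ring
  | hom a x hx =>
    induction y using weight_induction hρ with
    | add y y' hy hy' =>
      rw [mul_add, map_add, hy, hy', map_add]
      simp only [smul_eq_mul]
      ring
    | hom b y hy =>
      rw [hE _ _ (mul_mem_weightSpace hx hy), hE _ x hx, hE _ y hy]
      simp only [smul_eq_mul, mul_smul_comm, mul_comm y x, ← add_smul]
      push_cast
      rw [add_comm]

/-- The bilinear map `B` is homogeneous of weight `m`. -/
def BilinHasWeight (B : A →ₗ[ℂ] A →ₗ[ℂ] A) (ρ : ℂˣ →* (A ≃ₐ[ℂ] A)) (m : ℤ) : Prop :=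
  ∀ a b : ℤ, ∀ x ∈ weightSpace ρ a, ∀ y ∈ weightSpace ρ b, B x y ∈ weightSpace ρ (a + b + m)

/-- The infinitesimal form of `BilinHasWeight.torus_apply`. -/
theorem BilinHasWeight.euler_apply {B : A →ₗ[ℂ] A →ₗ[ℂ] A} {m : ℤ} (hB : BilinHasWeight B ρ m)
    (hρ : ⨆ n : ℤ, weightSpace ρ n = ⊤) {E : Derivation ℂ A A}
    (hE : ∀ n : ℤ, ∀ x ∈ weightSpace ρ n, E x = (n : ℂ) • x) (x y : A) :
    E (B x y) = B (E x) y + B x (E y) + (m : ℂ) • B x y := by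
  induction x using weight_induction hρ with
  | add x x' hx hx' =>
    simp only [map_add, LinearMap.add_apply, hx, hx', smul_add]
    abel
  | hom a x hx =>
    induction y using weight_induction hρ with
    | add y y' hy hy' =>
      simp only [map_add, hy, hy', smul_add]
      abel
    | hom b y hy =>
      rw [hE _ _ (hB a b x hx y hy), hE _ x hx, hE _ y hy]
      simp only [map_smul, LinearMap.smul_apply, ← add_smul]
      push_cast
      rfl

theorem BilinHasWeight.torus_apply {B : A →ₗ[ℂ] A →ₗ[ℂ] A} {m : ℤ} (hB : BilinHasWeight B ρ m)
    (hρ : ⨆ n : ℤ, weightSpace ρ n = ⊤) (t : ℂˣ) (x y : A) :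
    B (ρ t x) (ρ t y) = ((t : ℂ) ^ (-m)) • ρ t (B x y) := by
  induction x using weight_induction hρ with
  | add x x' hx hx' => simp only [map_add, LinearMap.add_apply, hx, hx', smul_add]
  | hom a x hx =>
    induction y using weight_induction hρ with
    | add y y' hy hy' => simp only [map_add, hy, hy', smul_add]
    | hom b y hy =>
      rw [hB a b x hx y hy t, hx t, hy t]
      simp only [map_smul, LinearMap.smul_apply, smul_smul, ← zpow_add₀ t.ne_zero]
      congr 2
      ring

theorem euler_torus_apply (hρ : ⨆ n : ℤ, weightSpace ρ n = ⊤) {E : Derivation ℂ A A}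
    (hE : ∀ n : ℤ, ∀ x ∈ weightSpace ρ n, E x = (n : ℂ) • x) (t : ℂˣ) (x : A) :
    E (ρ t x) = ρ t (E x) := by
  induction x using weight_induction hρ with
  | add x x' hx hx' => simp only [map_add, hx, hx']
  | hom a x hx => rw [hx t, Derivation.map_smul, hE a x hx, map_smul, hx t, smul_comm]

theorem inl_mem_weightSpace {a : ℤ} {x : A} (hx : x ∈ weightSpace ρ a) :
    (TrivSqZeroExt.inl x : DualNumber A) ∈ weightSpace (dualNumberAction ρ) a := by
  intro t
  ext
  · exact (add_zero _).trans (hx t)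
  · exact (zero_add _).trans ((map_zero (ρ t)).trans (smul_zero _).symm)

theorem fst_mem_weightSpace {a : ℤ} {x : DualNumber A}
    (hx : x ∈ weightSpace (dualNumberAction ρ) a) : x.fst ∈ weightSpace ρ a := fun t =>
  (add_zero _).symm.trans (congrArg TrivSqZeroExt.fst (hx t))

theorem snd_mem_weightSpace {a : ℤ} {x : DualNumber A}
    (hx : x ∈ weightSpace (dualNumberAction ρ) a) : x.snd ∈ weightSpace ρ a := fun t =>
  (zero_add _).symm.trans (congrArg TrivSqZeroExt.snd (hx t))

end Euler

/-! ### First order deformations of a Poisson bracket -/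

section Deformation

variable {R : Type*} [CommRing R] [Algebra ℂ R]

theorem eq_inl_add_eps_mul_inl (x : DualNumber R) :
    x = TrivSqZeroExt.inl x.fst + DualNumber.eps * TrivSqZeroExt.inl x.snd := by
  ext <;> simp

theorem eps_mul_eps_mul (x : DualNumber R) : DualNumber.eps * (DualNumber.eps * x) = 0 := by
  rw [← mul_assoc, DualNumber.eps_mul_eps, zero_mul]

namespace FirstOrderPoisson

variable (P : FirstOrderPoisson R)

/-- The bracket induced by a first order Poisson structure on the closed fibre. -/
def reduction : R →ₗ[ℂ] R →ₗ[ℂ] R :=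
  LinearMap.mk₂ ℂ (fun x y => (P.bracket (TrivSqZeroExt.inl x) (TrivSqZeroExt.inl y)).fst)
    (fun _ _ _ => by simp) (fun _ _ _ => by simp [TrivSqZeroExt.inl_smul])
    (fun _ _ _ => by simp) (fun _ _ _ => by simp [TrivSqZeroExt.inl_smul])

/-- The coefficient of `ε` in the bracket of two functions. -/
def deformation : R →ₗ[ℂ] R →ₗ[ℂ] R :=
  LinearMap.mk₂ ℂ (fun x y => (P.bracket (TrivSqZeroExt.inl x) (TrivSqZeroExt.inl y)).snd)
    (fun _ _ _ => by simp) (fun _ _ _ => by simp [TrivSqZeroExt.inl_smul])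
    (fun _ _ _ => by simp) (fun _ _ _ => by simp [TrivSqZeroExt.inl_smul])

theorem reduction_apply (x y : R) :
    P.reduction x y = (P.bracket (TrivSqZeroExt.inl x) (TrivSqZeroExt.inl y)).fst := rfl

theorem deformation_apply (x y : R) :
    P.deformation x y = (P.bracket (TrivSqZeroExt.inl x) (TrivSqZeroExt.inl y)).snd := rfl

theorem bracket_inl (x y : R) : P.bracket (TrivSqZeroExt.inl x) (TrivSqZeroExt.inl y) =
    TrivSqZeroExt.inl (P.reduction x y)
      + DualNumber.eps * TrivSqZeroExt.inl (P.deformation x y) := by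
  ext <;> simp [reduction_apply, deformation_apply]

theorem bracket_eq (x y : DualNumber R) : P.bracket x y =
    TrivSqZeroExt.inl (P.reduction x.fst y.fst) + DualNumber.eps * TrivSqZeroExt.inl
      (P.deformation x.fst y.fst + P.reduction x.snd y.fst + P.reduction x.fst y.snd) := by
  conv_lhs => rw [eq_inl_add_eps_mul_inl x, eq_inl_add_eps_mul_inl y]
  simp only [map_add, LinearMap.add_apply, eps_mul_left, eps_mul_right, bracket_inl, mul_add,
    eps_mul_eps_mul, add_zero, TrivSqZeroExt.inl_add]
  abel

theorem fst_bracket (x y : DualNumber R) : (P.bracket x y).fst = P.reduction x.fst y.fst := by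
  simp [bracket_eq]

theorem snd_bracket (x y : DualNumber R) : (P.bracket x y).snd =
    P.deformation x.fst y.fst + P.reduction x.snd y.fst + P.reduction x.fst y.snd := by
  simp [bracket_eq]

theorem reduction_self (x : R) : P.reduction x x = 0 := by
  rw [reduction_apply, P.self, TrivSqZeroExt.fst_zero]

theorem deformation_self (x : R) : P.deformation x x = 0 := by
  rw [deformation_apply, P.self, TrivSqZeroExt.snd_zero]

theorem deformation_leibniz (x y z : R) :
    P.deformation x (y * z) = y * P.deformation x z + z * P.deformation x y := by
  have h := congrArg TrivSqZeroExt.snd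
    (P.leibniz (TrivSqZeroExt.inl x) (TrivSqZeroExt.inl y) (TrivSqZeroExt.inl z))
  rw [← TrivSqZeroExt.inl_mul, ← deformation_apply] at h
  rw [h]
  simp only [TrivSqZeroExt.snd_add, TrivSqZeroExt.snd_mul, TrivSqZeroExt.fst_inl,
    TrivSqZeroExt.snd_inl, ← deformation_apply, op_smul_eq_smul, smul_eq_mul, mul_zero, zero_add,
    add_zero]
  ring

theorem reduction_jacobi (x y z : R) :
    P.reduction x (P.reduction y z) + P.reduction y (P.reduction z x)
      + P.reduction z (P.reduction x y) = 0 := by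
  have h := congrArg TrivSqZeroExt.fst
    (P.jacobi (TrivSqZeroExt.inl x) (TrivSqZeroExt.inl y) (TrivSqZeroExt.inl z))
  simpa [fst_bracket] using h

/-- The order one part of the Jacobi identity: the deformation is a Poisson cocycle. -/
theorem deformation_jacobi (x y z : R) :
    P.reduction x (P.deformation y z) + P.reduction y (P.deformation z x)
      + P.reduction z (P.deformation x y) + P.deformation x (P.reduction y z)
      + P.deformation y (P.reduction z x) + P.deformation z (P.reduction x y) = 0 := by
  have h := congrArg TrivSqZeroExt.snd
    (P.jacobi (TrivSqZeroExt.inl x) (TrivSqZeroExt.inl y) (TrivSqZeroExt.inl z))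
  simp only [TrivSqZeroExt.snd_add, snd_bracket, fst_bracket, TrivSqZeroExt.fst_inl,
    TrivSqZeroExt.snd_inl, map_zero, LinearMap.zero_apply, add_zero,
    TrivSqZeroExt.snd_zero] at h
  rw [← h]
  abel

variable {P} {ρ : ℂˣ →* (R ≃ₐ[ℂ] R)} {m : ℤ}

theorem HasWeight.reduction (h : P.HasWeight ρ m) : BilinHasWeight P.reduction ρ m :=
  fun a b _ hx _ hy =>
    fst_mem_weightSpace (h a b _ (inl_mem_weightSpace hx) _ (inl_mem_weightSpace hy))

theorem HasWeight.deformation (h : P.HasWeight ρ m) : BilinHasWeight P.deformation ρ m :=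
  fun a b _ hx _ hy =>
    snd_mem_weightSpace (h a b _ (inl_mem_weightSpace hx) _ (inl_mem_weightSpace hy))

end FirstOrderPoisson

/-- The automorphism `id + ε v` of `R[ε]` given by a vector field `v`. -/
def infinitesimalAut (v : Derivation ℂ R R) : DualNumber R ≃ₐ[ℂ] DualNumber R where
  toFun x := TrivSqZeroExt.inl x.fst + TrivSqZeroExt.inr (x.snd + v x.fst)
  invFun x := TrivSqZeroExt.inl x.fst + TrivSqZeroExt.inr (x.snd - v x.fst)
  left_inv x := by ext <;> simp
  right_inv x := by ext <;> simp
  map_mul' x y := by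
    ext
    · simp
    · simp only [Derivation.leibniz, TrivSqZeroExt.snd_add, TrivSqZeroExt.snd_mul,
        TrivSqZeroExt.snd_inl, TrivSqZeroExt.snd_inr, TrivSqZeroExt.fst_add,
        TrivSqZeroExt.fst_mul, TrivSqZeroExt.fst_inl, TrivSqZeroExt.fst_inr, op_smul_eq_smul,
        smul_eq_mul, zero_add, add_zero]
      ring
  map_add' x y := by
    ext
    · simp
    · simp only [TrivSqZeroExt.snd_add, TrivSqZeroExt.snd_inl, TrivSqZeroExt.snd_inr,
        TrivSqZeroExt.fst_add, map_add, zero_add]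
      abel
  commutes' c := by ext <;> simp [TrivSqZeroExt.algebraMap_eq_inl']

@[simp]
theorem fst_infinitesimalAut (v : Derivation ℂ R R) (x : DualNumber R) :
    (infinitesimalAut v x).fst = x.fst := add_zero _

@[simp]
theorem snd_infinitesimalAut (v : Derivation ℂ R R) (x : DualNumber R) :
    (infinitesimalAut v x).snd = x.snd + v x.fst := zero_add _

/-- The automorphism `id + ε v` carries one deformation to another as soon as their difference is
the coboundary of `v`. -/
theorem infinitesimalAut_bracket {P₁ P₂ : FirstOrderPoisson R} (hred : P₁.reduction = P₂.reduction)
    (v : Derivation ℂ R R)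
    (hv : ∀ x y, P₁.reduction (v x) y + P₁.reduction x (v y) - v (P₁.reduction x y)
      = P₁.deformation x y - P₂.deformation x y) (x y : DualNumber R) :
    infinitesimalAut v (P₁.bracket x y)
      = P₂.bracket (infinitesimalAut v x) (infinitesimalAut v y) := by
  ext
  · simp [FirstOrderPoisson.fst_bracket, hred]
  · simp only [snd_infinitesimalAut, fst_infinitesimalAut, FirstOrderPoisson.fst_bracket,
      FirstOrderPoisson.snd_bracket, ← hred, map_add, LinearMap.add_apply]
    linear_combination -(hv x.fst y.fst)

end Deformation

/-! ### Hamiltonian vector fields -/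

section Hamiltonian

variable {R : Type*} [CommRing R] [IsDomain R] [Algebra ℂ R]

namespace SymplecticForm

variable (ω : SymplecticForm R)

theorem form_hamiltonian_left (f : FractionRing R) (Z : RatField R) :
    ω.form (ω.hamiltonian f) Z = Z f :=
  (ω.existsUnique_hamiltonian f).choose_spec.1 Z

theorem form_hamiltonian_right (f : FractionRing R) (Z : RatField R) :
    ω.form Z (ω.hamiltonian f) = -Z f := by
  rw [← ω.form_hamiltonian_left f Z]
  exact (LinearMap.IsAlt.neg ω.alt _ _).symm

theorem bracket_eq (f g : FractionRing R) : ω.bracket f g = ω.hamiltonian g f :=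
  ω.form_hamiltonian_left f _

/-- Nondegeneracy at the generic point. -/
theorem exists_form_eq (φ : RatField R →ₗ[FractionRing R] FractionRing R) :
    ∃ D : RatField R, ∀ Z : RatField R, ω.form D Z = φ Z := by
  let α : vectorFieldsAt (⊥ : PrimeSpectrum R) →ₗ[localRing (⊥ : PrimeSpectrum R)]
      localRing (⊥ : PrimeSpectrum R) :=
    { toFun := fun D => ⟨φ (D : RatField R), mem_localRing_bot _⟩
      map_add' := fun D E => Subtype.ext (map_add φ (D : RatField R) (E : RatField R))
      map_smul' := fun c D =>
        Subtype.ext (map_smul φ (c : FractionRing R) (D : RatField R)) }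
  obtain ⟨D, hD, -⟩ := ω.nondegenerate ⊥ bot_mem_regularPart α
  exact ⟨D, fun Z => hD ⟨Z, fun g _ => mem_localRing_bot _⟩⟩

/-- Any rational vector field is a combination of Hamiltonian ones: a functional that vanishes on
these is `ω(D, ·)` for a vector field `D` that kills all functions. -/
theorem span_hamiltonian : Submodule.span (FractionRing R)
    (Set.range fun f : R => ω.hamiltonian (algebraMap R _ f)) = ⊤ := by
  by_contra hne
  obtain ⟨φ, hφ, hker⟩ := Submodule.exists_le_ker_of_lt_top _ (lt_top_iff_ne_top.mpr hne)
  obtain ⟨D, hD⟩ := ω.exists_form_eq φ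
  have hD0 : D = 0 := by
    refine RatField.ext_of_algebraMap fun f => ?_
    have hf : φ (ω.hamiltonian (algebraMap R _ f)) = 0 :=
      hker (Submodule.subset_span ⟨f, rfl⟩)
    rw [← hD, form_hamiltonian_right, neg_eq_zero] at hf
    rw [hf, Derivation.zero_apply]
  refine hφ (LinearMap.ext fun Z => ?_)
  rw [← hD, hD0, map_zero]

end SymplecticForm

end Hamiltonian

/-! ### Poisson cocycles of the weight of the bracket are coboundaries -/

section Cocycle

variable {R : Type*} [CommRing R] [IsDomain R] [Algebra ℂ R] {ω : SymplecticForm R}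
  {π : R →ₗ[ℂ] R →ₗ[ℂ] R} {E : Derivation ℂ R R} {l : ℂ}

local notation "ι" => algebraMap R (FractionRing R)

theorem hamiltonian_algebraMap (hπ : ∀ x y, ι (π x y) = ω.bracket (ι x) (ι y)) (x y : R) :
    ω.hamiltonian (ι x) (ι y) = ι (π y x) := by
  rw [hπ, SymplecticForm.bracket_eq]

theorem neg_of_self {δ : R →ₗ[ℂ] R →ₗ[ℂ] R} (hδ : ∀ x, δ x x = 0) (x y : R) :
    δ x y = -δ y x := by
  have h := hδ (x + y)
  simp only [map_add, LinearMap.add_apply, hδ, zero_add, add_zero] at h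
  exact eq_neg_of_add_eq_zero_right h

/-- The sign of the bracket on the right comes from the convention `{f, g} = H_g f`. -/
theorem lie_hamiltonian (hπ : ∀ x y, ι (π x y) = ω.bracket (ι x) (ι y))
    (hself : ∀ x, π x x = 0)
    (hjac : ∀ x y z, π x (π y z) + π y (π z x) + π z (π x y) = 0) (x y : R) :
    ⁅ω.hamiltonian (ι x), ω.hamiltonian (ι y)⁆ = ω.hamiltonian (ι (π y x)) := by
  refine RatField.ext_of_algebraMap fun g => ?_
  rw [Derivation.commutator_apply]
  simp only [hamiltonian_algebraMap hπ, ← map_sub]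
  congr 1
  rw [neg_of_self hself (π g y) x, neg_of_self hself (π g x) y, neg_of_self hself g x]
  have h := hjac x g y
  rw [neg_of_self hself y x, map_neg] at h ⊢
  simp only [map_neg]
  linear_combination -h

/-- The identity `d(i_E ω) = l ω` for the Euler vector field `E`. It is an identity of 2-forms, and
on Hamiltonian vector fields it says that the bracket has weight `-l`. -/
theorem exteriorDerivative_contraction
    (hπ : ∀ x y, ι (π x y) = ω.bracket (ι x) (ι y)) (hself : ∀ x, π x x = 0)
    (hjac : ∀ x y z, π x (π y z) + π y (π z x) + π z (π x y) = 0)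
    (hE : ∀ x y, E (π x y) = π (E x) y + π x (E y) - l • π x y) (y : R) (D : RatField R) :
    ω.hamiltonian (ι y) (ω.form (extendToField E) D)
      - D (ω.form (extendToField E) (ω.hamiltonian (ι y)))
      - ω.form (extendToField E) ⁅ω.hamiltonian (ι y), D⁆
      = l • ω.form (ω.hamiltonian (ι y)) D := by
  have hD : D ∈ Submodule.span (FractionRing R)
      (Set.range fun f : R => ω.hamiltonian (ι f)) := by
    rw [ω.span_hamiltonian]
    trivial
  -- Both sides are linear over the function field in `D`: the terms in derivatives of the
  -- coefficients cancel.
  induction hD using Submodule.span_induction with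
  | mem D hD =>
    obtain ⟨x, rfl⟩ := hD
    simp only [lie_hamiltonian hπ hself hjac, SymplecticForm.form_hamiltonian_right,
      extendToField_algebraMap, map_neg, hamiltonian_algebraMap hπ, hE, map_add, map_sub]
    rw [neg_of_self hself (E y) x]
    rw [map_neg, Algebra.algebraMap_eq_smul_one (l • π x y), smul_assoc,
      ← Algebra.algebraMap_eq_smul_one, smul_neg]
    ring
  | zero =>
    have hlie : ⁅ω.hamiltonian (ι y), (0 : RatField R)⁆ = 0 := by
      ext f
      simp only [Derivation.commutator_apply, Derivation.zero_apply, map_zero, sub_zero]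
    rw [hlie]
    simp
  | add D D' _ _ hD hD' =>
    have hlie : ⁅ω.hamiltonian (ι y), D + D'⁆
        = ⁅ω.hamiltonian (ι y), D⁆ + ⁅ω.hamiltonian (ι y), D'⁆ := by
      ext f
      simp only [Derivation.commutator_apply, Derivation.add_apply, map_add]
      ring
    rw [hlie]
    simp only [map_add, Derivation.add_apply, smul_add, ← hD, ← hD']
    ring
  | smul c D _ hD =>
    have hlie : ⁅ω.hamiltonian (ι y), c • D⁆
        = c • ⁅ω.hamiltonian (ι y), D⁆ + ω.hamiltonian (ι y) c • D := by
      ext f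
      simp only [Derivation.commutator_apply, Derivation.smul_apply, Derivation.add_apply,
        Derivation.leibniz, smul_eq_mul]
      ring
    rw [hlie]
    simp only [map_smul, map_add, Derivation.leibniz, Derivation.smul_apply, smul_eq_mul] at hD ⊢
    rw [← mul_smul_comm, ← hD]
    ring

/-- The vector field `δ(·, f)` of an alternating biderivation `δ`. For the Poisson bracket this is
the Hamiltonian vector field of `f`. -/
def biderivationField (δ : R →ₗ[ℂ] R →ₗ[ℂ] R) (hself : ∀ x, δ x x = 0)
    (hδ : ∀ x y z, δ x (y * z) = y * δ x z + z * δ x y) (f : R) : Derivation ℂ R R :=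
  Derivation.mk' (δ.flip f) fun x y => by
    simp only [LinearMap.flip_apply, smul_eq_mul]
    rw [neg_of_self hself, hδ, neg_of_self hself x, neg_of_self hself y]
    ring

variable {δ : R →ₗ[ℂ] R →ₗ[ℂ] R}

@[simp]
theorem biderivationField_apply (hself : ∀ x, δ x x = 0)
    (hδ : ∀ x y z, δ x (y * z) = y * δ x z + z * δ x y) (f g : R) :
    biderivationField δ hself hδ f g = δ g f := rfl

/-- The cocycle condition for `δ`, as an expression for the vector field `δ(·, {x, y})`. -/
theorem extendToField_biderivationField_bracket
    (hπ : ∀ x y, ι (π x y) = ω.bracket (ι x) (ι y)) (hπself : ∀ x, π x x = 0)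
    (hself : ∀ x, δ x x = 0) (hδ : ∀ x y z, δ x (y * z) = y * δ x z + z * δ x y)
    (hcocycle : ∀ x y z, π x (δ y z) + π y (δ z x) + π z (δ x y)
      + δ x (π y z) + δ y (π z x) + δ z (π x y) = 0) (x y : R) :
    extendToField (biderivationField δ hself hδ (π x y))
      = ⁅ω.hamiltonian (ι y), extendToField (biderivationField δ hself hδ x)⁆
        - ⁅ω.hamiltonian (ι x), extendToField (biderivationField δ hself hδ y)⁆
        - ω.hamiltonian (ι (δ x y)) := by
  refine RatField.ext_of_algebraMap fun g => ?_
  simp only [Derivation.sub_apply, Derivation.commutator_apply, extendToField_algebraMap,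
    biderivationField_apply, hamiltonian_algebraMap hπ, ← map_sub]
  congr 1
  have h := hcocycle g x y
  rw [neg_of_self hπself (δ g x) y, neg_of_self hπself (δ g y) x, neg_of_self hself (π g y) x,
    neg_of_self hself (π g x) y, neg_of_self hself g y, neg_of_self hπself g y]
  simp only [map_neg]
  linear_combination h

/-- If the cocycle `δ` has the weight of the bracket, it is the coboundary of the vector field
`v`, where `l v(f) = -ω(E, δ(·, f))`. In terms of the closed 2-form `α` that corresponds to `δ`,
this is the homotopy formula `l α = d(i_E α)`. -/
theorem cocycle_eq_coboundary (hl : l ≠ 0)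
    (hπ : ∀ x y, ι (π x y) = ω.bracket (ι x) (ι y)) (hπself : ∀ x, π x x = 0)
    (hjac : ∀ x y z, π x (π y z) + π y (π z x) + π z (π x y) = 0)
    (hEπ : ∀ x y, E (π x y) = π (E x) y + π x (E y) - l • π x y)
    (hself : ∀ x, δ x x = 0) (hδ : ∀ x y z, δ x (y * z) = y * δ x z + z * δ x y)
    (hcocycle : ∀ x y z, π x (δ y z) + π y (δ z x) + π z (δ x y)
      + δ x (π y z) + δ y (π z x) + δ z (π x y) = 0)
    (hEδ : ∀ x y, E (δ x y) = δ (E x) y + δ x (E y) - l • δ x y)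
    {v : R → R} (hv : ∀ f, l • ι (v f)
      = -ω.form (extendToField E) (extendToField (biderivationField δ hself hδ f))) (x y : R) :
    π (v x) y + π x (v y) - v (π x y) = δ x y := by
  have hx := exteriorDerivative_contraction hπ hπself hjac hEπ x
    (extendToField (biderivationField δ hself hδ y))
  have hy := exteriorDerivative_contraction hπ hπself hjac hEπ y
    (extendToField (biderivationField δ hself hδ x))
  have hvxy := hv (π x y)
  -- The terms in `ω(E, ·)` combine to `d(i_E ω)(H_x, δ(·, y)) - d(i_E ω)(H_y, δ(·, x))`.
  rw [extendToField_biderivationField_bracket hπ hπself hself hδ hcocycle] at hvxy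
  have hvx := congrArg (ω.hamiltonian (ι y)) (hv x)
  have hvy := congrArg (ω.hamiltonian (ι x)) (hv y)
  have hE := congrArg ι (hEδ x y)
  have hsmul (f : R) : ι (l • f) = l • ι f := by
    rw [Algebra.algebraMap_eq_smul_one, smul_assoc, ← Algebra.algebraMap_eq_smul_one]
  simp only [map_neg, map_sub, map_add, SymplecticForm.form_hamiltonian_left,
    SymplecticForm.form_hamiltonian_right, extendToField_algebraMap, biderivationField_apply,
    Derivation.map_smul, hamiltonian_algebraMap hπ, hsmul] at hx hy hvxy hvx hvy hE
  rw [neg_of_self hπself x (v y)]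
  rw [neg_of_self hself (E y) x] at hy
  rw [neg_of_self hself y x] at hy
  simp only [map_neg, smul_neg] at hy
  apply IsFractionRing.injective R (FractionRing R)
  apply smul_right_injective (FractionRing R) hl
  simp only [map_add, map_sub, map_neg, smul_add, smul_sub, smul_neg]
  linear_combination hvx - hvy - hvxy - hy + hx + hE

end Cocycle

/-! ### The vector field that integrates a cocycle -/

section Potential

variable {R : Type*} [CommRing R] [IsDomain R] [Algebra ℂ R] {ω : SymplecticForm R}

local notation "ι" => algebraMap R (FractionRing R)

theorem extendToField_mem_vectorFieldsAt (D : Derivation ℂ R R) (p : PrimeSpectrum R) :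
    extendToField D ∈ vectorFieldsAt p :=
  mem_vectorFieldsAt_of_algebraMap (fun a => ⟨D a, extendToField_algebraMap D a⟩) p

/-- On a normal variety `ω` takes regular values on vector fields that extend to `X`. -/
theorem SymplecticForm.exists_algebraMap_eq_form [IsNoetherianRing R] [IsIntegrallyClosed R]
    (ω : SymplecticForm R) (D E : Derivation ℂ R R) :
    ∃ r : R, ι r = ω.form (extendToField D) (extendToField E) :=
  mem_range_of_forall_mem_regularPart _ fun p hp =>
    ω.regular p hp _ (extendToField_mem_vectorFieldsAt D p) _ (extendToField_mem_vectorFieldsAt E p)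

/-- The vector field `f ↦ c ω(E, δ(·, f))`. -/
theorem exists_derivation_eq_form [IsNoetherianRing R] [IsIntegrallyClosed R]
    (ω : SymplecticForm R) (E : Derivation ℂ R R) {δ : R →ₗ[ℂ] R →ₗ[ℂ] R}
    (hself : ∀ x, δ x x = 0) (hδ : ∀ x y z, δ x (y * z) = y * δ x z + z * δ x y) (c : ℂ) :
    ∃ v : Derivation ℂ R R, ∀ f, ι (v f)
      = c • ω.form (extendToField E) (extendToField (biderivationField δ hself hδ f)) := by
  choose w hw using fun f => ω.exists_algebraMap_eq_form E (biderivationField δ hself hδ f)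
  have hinj := IsFractionRing.injective R (FractionRing R)
  have hadd (f g : R) : w (f + g) = w f + w g := by
    apply hinj
    have h : extendToField (biderivationField δ hself hδ (f + g))
        = extendToField (biderivationField δ hself hδ f)
          + extendToField (biderivationField δ hself hδ g) :=
      RatField.ext_of_algebraMap fun a => by
        simp only [Derivation.add_apply, extendToField_algebraMap, biderivationField_apply, map_add]
    rw [hw, h, map_add, map_add, hw, hw]
  have hmul (f g : R) : w (f * g) = f * w g + g * w f := by
    apply hinj
    have h : extendToField (biderivationField δ hself hδ (f * g))
        = ι f • extendToField (biderivationField δ hself hδ g)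
          + ι g • extendToField (biderivationField δ hself hδ f) :=
      RatField.ext_of_algebraMap fun a => by
        simp only [Derivation.add_apply, Derivation.smul_apply, extendToField_algebraMap,
          biderivationField_apply, hδ, map_add, map_mul, smul_eq_mul]
    rw [hw, h, map_add, map_smul, map_smul, map_add, map_mul, map_mul, hw, hw, smul_eq_mul,
      smul_eq_mul]
  have hconst (a : ℂ) : w (algebraMap ℂ R a) = 0 := by
    apply hinj
    have h : extendToField (biderivationField δ hself hδ (algebraMap ℂ R a)) = 0 :=
      RatField.ext_of_algebraMap fun g => by
        rw [extendToField_algebraMap, biderivationField_apply, neg_of_self hself]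
        have := (biderivationField δ hself hδ g).map_algebraMap a
        rw [biderivationField_apply] at this
        simp [this]
    rw [hw, h, map_zero, map_zero]
  let v : Derivation ℂ R R := Derivation.mk'
    { toFun := w
      map_add' := hadd
      map_smul' := fun a f => by
        rw [Algebra.smul_def, hmul, hconst, mul_zero, add_zero, RingHom.id_apply,
          Algebra.smul_def] } hmul
  refine ⟨c • v, fun f => ?_⟩
  rw [← hw, Derivation.smul_apply, Algebra.algebraMap_eq_smul_one (c • v f), smul_assoc,
    ← Algebra.algebraMap_eq_smul_one]
  rfl

theorem fieldMap_algebraMap (σ : R ≃ₐ[ℂ] R) (a : R) : fieldMap σ (ι a) = ι (σ a) :=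
  IsFractionRing.fieldEquivOfAlgEquiv_algebraMap ℂ (FractionRing R) (FractionRing R) σ a

theorem fieldMap_symm_algebraMap (σ : R ≃ₐ[ℂ] R) (a : R) :
    (fieldMap σ).symm (ι a) = ι (σ.symm a) := by
  rw [AlgEquiv.symm_apply_eq, fieldMap_algebraMap, AlgEquiv.apply_symm_apply]

theorem pushforward_algebraMap (σ : R ≃ₐ[ℂ] R) (D : Derivation ℂ R R) (a : R) :
    pushforward σ (extendToField D) (ι a) = ι (σ.symm (D (σ a))) := by
  change (fieldMap σ).symm (extendToField D (fieldMap σ (ι a))) = _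
  rw [fieldMap_algebraMap, extendToField_algebraMap, fieldMap_symm_algebraMap]

/-- If `δ` has the weight `-l` opposite to that of `ω`, the vector field `c ω(E, δ(·, f))` is
invariant under the torus. -/
theorem torus_apply_of_eq_form {ρ : ℂˣ →* (R ≃ₐ[ℂ] R)} (hρ : ⨆ n : ℤ, weightSpace ρ n = ⊤)
    {l : ℤ} (hω : ω.HasWeight ρ l) {E : Derivation ℂ R R}
    (hE : ∀ n : ℤ, ∀ x ∈ weightSpace ρ n, E x = (n : ℂ) • x) {δ : R →ₗ[ℂ] R →ₗ[ℂ] R}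
    (hself : ∀ x, δ x x = 0) (hδ : ∀ x y z, δ x (y * z) = y * δ x z + z * δ x y)
    (hw : BilinHasWeight δ ρ (-l)) {c : ℂ} {v : R → R} (hv : ∀ f, ι (v f)
      = c • ω.form (extendToField E) (extendToField (biderivationField δ hself hδ f)))
    (t : ℂˣ) (f : R) : v (ρ t f) = ρ t (v f) := by
  apply IsFractionRing.injective R (FractionRing R)
  have ht : (t : ℂ) ^ l ≠ 0 := zpow_ne_zero _ t.ne_zero
  have hpE : pushforward (ρ t) (extendToField E) = extendToField E :=
    RatField.ext_of_algebraMap fun a => by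
      rw [pushforward_algebraMap, extendToField_algebraMap, euler_torus_apply hρ hE,
        AlgEquiv.symm_apply_apply]
  have hpδ : pushforward (ρ t) (extendToField (biderivationField δ hself hδ (ρ t f)))
      = ι (algebraMap ℂ R ((t : ℂ) ^ l)) • extendToField (biderivationField δ hself hδ f) :=
    RatField.ext_of_algebraMap fun a => by
      rw [pushforward_algebraMap, biderivationField_apply, hw.torus_apply hρ, neg_neg, map_smul,
        AlgEquiv.symm_apply_apply, Derivation.smul_apply, extendToField_algebraMap,
        biderivationField_apply, Algebra.smul_def, map_mul, smul_eq_mul]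
  have h := hω t (extendToField E) (extendToField (biderivationField δ hself hδ (ρ t f)))
  rw [hpE, hpδ, map_smul, smul_eq_mul, map_mul, fieldMap_algebraMap, AlgEquiv.commutes,
    ← IsScalarTower.algebraMap_apply, ← Algebra.smul_def] at h
  have h' := smul_right_injective _ ht h
  rw [← fieldMap_algebraMap, hv, hv, map_smul, h']

end Potential

end SymplecticCone

end

theorem mainTheorem5 {R : Type*} [CommRing R] [IsDomain R] [Algebra ℂ R]
    [Algebra.FiniteType ℂ R] [IsIntegrallyClosed R]
    (ρ : ℂˣ →* (R ≃ₐ[ℂ] R)) (hρ : SymplecticCone.IsPositiveAction ρ)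
    (ω : SymplecticCone.SymplecticForm R) (l : ℤ) (hl : l ≠ 0) (hω : ω.HasWeight ρ l)
    (P₁ P₂ : SymplecticCone.FirstOrderPoisson R)
    (hP₁ : P₁.Extends ω) (hP₂ : P₂.Extends ω)
    (hw₁ : P₁.HasWeight ρ (-l)) (hw₂ : P₂.HasWeight ρ (-l)) :
    ∃ Φ : DualNumber R ≃ₐ[ℂ] DualNumber R,
      Φ DualNumber.eps = DualNumber.eps ∧
      (∀ x, (Φ x).fst = x.fst) ∧
      (∀ (t : ℂˣ) (x : DualNumber R),
        Φ (SymplecticCone.dualNumberAction ρ t x) = SymplecticCone.dualNumberAction ρ t (Φ x)) ∧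
      ∀ x y, Φ (P₁.bracket x y) = P₂.bracket (Φ x) (Φ y) := by
  open SymplecticCone in
  have : IsNoetherianRing R := Algebra.FiniteType.isNoetherianRing ℂ R
  have hlC : (l : ℂ) ≠ 0 := Int.cast_ne_zero.mpr hl
  have hπ (x y : R) : algebraMap R (FractionRing R) (P₁.reduction x y)
      = ω.bracket (algebraMap R _ x) (algebraMap R _ y) :=
    hP₁ (TrivSqZeroExt.inl x) (TrivSqZeroExt.inl y)
  have hred : P₁.reduction = P₂.reduction := by
    ext x y
    apply IsFractionRing.injective R (FractionRing R)
    rw [hπ]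
    exact (hP₂ (TrivSqZeroExt.inl x) (TrivSqZeroExt.inl y)).symm
  -- The two deformations differ by a Poisson cocycle of weight `-l`.
  let δ := P₁.deformation - P₂.deformation
  have hself (x : R) : δ x x = 0 := by
    simp [δ, FirstOrderPoisson.deformation_self]
  have hδ (x y z : R) : δ x (y * z) = y * δ x z + z * δ x y := by
    simp only [δ, LinearMap.sub_apply, FirstOrderPoisson.deformation_leibniz]
    ring
  have hcocycle (x y z : R) : P₁.reduction x (δ y z) + P₁.reduction y (δ z x)
      + P₁.reduction z (δ x y) + δ x (P₁.reduction y z) + δ y (P₁.reduction z x)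
      + δ z (P₁.reduction x y) = 0 := by
    have h₁ := P₁.deformation_jacobi x y z
    have h₂ := P₂.deformation_jacobi x y z
    rw [← hred] at h₂
    simp only [δ, LinearMap.sub_apply, map_sub]
    linear_combination h₁ - h₂
  have hw : BilinHasWeight δ ρ (-l) := fun a b x hx y hy =>
    sub_mem (hw₁.deformation a b x hx y hy) (hw₂.deformation a b x hx y hy)
  obtain ⟨E, hE⟩ := exists_euler hρ.algebraic
  have hEB {B : R →ₗ[ℂ] R →ₗ[ℂ] R} (hB : BilinHasWeight B ρ (-l)) (x y : R) :
      E (B x y) = B (E x) y + B x (E y) - (l : ℂ) • B x y := by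
    rw [hB.euler_apply hρ.algebraic hE, Int.cast_neg, neg_smul, sub_eq_add_neg]
  obtain ⟨v, hv⟩ := exists_derivation_eq_form ω E hself hδ (-(l : ℂ)⁻¹)
  have hcob := cocycle_eq_coboundary hlC hπ P₁.reduction_self P₁.reduction_jacobi
    (hEB hw₁.reduction) hself hδ hcocycle (hEB hw) (v := v) fun f => by
      rw [hv, smul_smul, mul_neg, mul_inv_cancel₀ hlC, neg_one_smul]
  refine ⟨infinitesimalAut v, ?_, fst_infinitesimalAut v, fun t x => ?_,
    infinitesimalAut_bracket hred v hcob⟩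
  · ext <;> simp
  · have hinv := torus_apply_of_eq_form hρ.algebraic hω hE hself hδ hw hv t x.fst
    ext <;> simp [dualNumberAction, dualNumberMap, hinv, add_comm]
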